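/- Let $\mathbb{D}=\{z\in\mathbb{C}:|z|<1\}$ and let $\varphi$ be analytic and univalent in $\mathbb{D}$ with $\operatorname{Re}\varphi(z)>0$ for $z\in\mathbb{D}$ and with a Taylor expansion $$\varphi(z)=1+B_1z+B_2z^2+B_3z^3+\cdots,\qquad B_1>0,$$ with real coefficients $B_n$ (equivalently, $\varphi(\mathbb{D})$ is symmetric with respect to the real axis). Let $\mathcal{C}_s(\varphi)$ be the class of analytic functions $f$ on $\mathbb{D}$ with $f(0)=0$, $f'(0)=1$ and $$\frac{(2zf'(z))'}{(f(z)-f(-z))'}\prec\varphi(z),$$ where $F\prec G$ means that $F=G\circ\omega$ on $\mathbb{D}$ for some analytic $\omega:\mathbb{D}\to\mathbb{D}$ with $\omega(0)=0$. Suppose that the coefficients of $\varphi$ satisfy the four conditions C1: $\;|B_1^3-2B_1B_2+2B_2^2|<|2B_1^2-B_1^3-2B_1B_2|$; C2: $\;|B_1^3-B_1^2B_2+3B_2^2-3B_1B_3|<3\,|B_1^3-B_1^2+B_2^2|$; C3: $\;\big|B_1^7-B_1^6(8B_2+3)-6B_1^4\big(B_2(3B_2+2B_3+2)-6B_3+9B_4\big)+B_1^5\big(7B_2(B_2+4)-24B_3+18B_4\big)+6B_1^3\big(B_2^3-2B_2^2+8B_2B_3-3B_3^2+6(B_2+1)B_4\big)-6B_1B_2\big(3B_2^3-6B_3^2+B_2^2(4B_3-6)+6B_2(B_4-2B_3)\big)+18B_2^2\big(-2B_3^2+B_2((B_2-2)B_2+2B_4)\big)+B_1^2B_2\big(B_2(B_2(5B_2+6)-24B_3+18B_4)-36(2B_3+B_4)\big)\big|$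 $\quad<2\,\big|\big((B_1-2)B_1+2B_2\big)\big(B_1(2B_1+B_2-3)+3B_3\big)\big(4B_1^3+6B_2^2-B_1^2(B_2+3)-3B_1B_3\big)\big|$; C4: $\;0<\dfrac{2B_1-B_1^2-2B_2}{2(B_1-B_2)}<1$. Then every $f(z)=z+a_2z^2+a_3z^3+\cdots\in\mathcal{C}_s(\varphi)$ satisfies $$|a_5|\le\frac{B_1}{20}.$$ The bound is sharp for every such $\varphi$: there is a function $g\in\mathcal{C}_s(\varphi)$ with $$\frac{(2zg'(z))'}{(g(z)-g(-z))'}=\varphi(z^4)\qquad(z\in\mathbb{D}),$$ whose fifth Taylor coefficient equals $B_1/20$. -/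

import Mathlib

noncomputable section

namespace Sakaguchi

/-- The open unit disk `𝔻`. -/
def disk : Set ℂ := Metric.ball 0 1

/-- The `n`-th Taylor coefficient of `f` at the origin. -/
def taylorCoeff (f : ℂ → ℂ) (n : ℕ) : ℂ := iteratedDeriv n f 0 / (n.factorial : ℂ)

/-- The class `𝒜`: holomorphic functions on the unit disk with `f 0 = 0` and `f' 0 = 1`. -/
structure ClassA (f : ℂ → ℂ) : Prop where
  holo : DifferentiableOn ℂ f disk
  map_zero : f 0 = 0
  deriv_zero : deriv f 0 = 1

/-- Schwarz functions: holomorphic self-maps of the unit disk that fix the origin. -/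
structure IsSchwarz (ω : ℂ → ℂ) : Prop where
  holo : DifferentiableOn ℂ ω disk
  maps : Set.MapsTo ω disk disk
  map_zero : ω 0 = 0

/-- Subordination `F ≺ G` on the unit disk. -/
def Subordinate (F G : ℂ → ℂ) : Prop :=
  ∃ ω : ℂ → ℂ, IsSchwarz ω ∧ ∀ z ∈ disk, F z = G (ω z)

/-- The expression `(2 z f'(z))' / (f(z) - f(-z))'`. -/
def symConvexQuot (f : ℂ → ℂ) (z : ℂ) : ℂ :=
  deriv (fun w => 2 * w * deriv f w) z / deriv (fun w => f w - f (-w)) z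

/-- The class `𝒞ₛ(φ)`. The field `denom_ne` says that the quotient is a genuine one
on the whole disk. -/
structure ClassCs (φ f : ℂ → ℂ) : Prop where
  classA : ClassA f
  denom_ne : ∀ z ∈ disk, deriv (fun w => f w - f (-w)) z ≠ 0
  subord : Subordinate (symConvexQuot f) φ

/-- The admissible functions `φ`: holomorphic and univalent on the unit disk, with positive real
part and `φ 0 = 1`, and with real Taylor coefficients `B n` such that `B 1 > 0`. For a univalent
`φ` with `φ' 0 > 0` and `φ 0 = 1`, real coefficients mean that `φ(𝔻)` is symmetric with respect
to the real axis. -/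
structure Admissible (φ : ℂ → ℂ) (B : ℕ → ℝ) : Prop where
  holo : DifferentiableOn ℂ φ disk
  univalent : Set.InjOn φ disk
  map_zero : φ 0 = 1
  re_pos : ∀ z ∈ disk, 0 < (φ z).re
  coeff : ∀ n, taylorCoeff φ n = (B n : ℂ)
  B_one_pos : 0 < B 1

/-- Condition C1. -/
def C1 (B₁ B₂ : ℝ) : Prop :=
  |B₁ ^ 3 - 2 * B₁ * B₂ + 2 * B₂ ^ 2| < |2 * B₁ ^ 2 - B₁ ^ 3 - 2 * B₁ * B₂|

/-- Condition C2. -/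
def C2 (B₁ B₂ B₃ : ℝ) : Prop :=
  |B₁ ^ 3 - B₁ ^ 2 * B₂ + 3 * B₂ ^ 2 - 3 * B₁ * B₃| < 3 * |B₁ ^ 3 - B₁ ^ 2 + B₂ ^ 2|

/-- Condition C3. -/
def C3 (B₁ B₂ B₃ B₄ : ℝ) : Prop :=
  |B₁ ^ 7 - B₁ ^ 6 * (8 * B₂ + 3)
      - 6 * B₁ ^ 4 * (B₂ * (3 * B₂ + 2 * B₃ + 2) - 6 * B₃ + 9 * B₄)
      + B₁ ^ 5 * (7 * B₂ * (B₂ + 4) - 24 * B₃ + 18 * B₄)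
      + 6 * B₁ ^ 3 * (B₂ ^ 3 - 2 * B₂ ^ 2 + 8 * B₂ * B₃ - 3 * B₃ ^ 2 + 6 * (B₂ + 1) * B₄)
      - 6 * B₁ * B₂ * (3 * B₂ ^ 3 - 6 * B₃ ^ 2 + B₂ ^ 2 * (4 * B₃ - 6)
          + 6 * B₂ * (B₄ - 2 * B₃))
      + 18 * B₂ ^ 2 * (-2 * B₃ ^ 2 + B₂ * ((B₂ - 2) * B₂ + 2 * B₄))
      + B₁ ^ 2 * B₂ * (B₂ * (B₂ * (5 * B₂ + 6) - 24 * B₃ + 18 * B₄)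
          - 36 * (2 * B₃ + B₄))|
    < 2 * |((B₁ - 2) * B₁ + 2 * B₂) * (B₁ * (2 * B₁ + B₂ - 3) + 3 * B₃)
        * (4 * B₁ ^ 3 + 6 * B₂ ^ 2 - B₁ ^ 2 * (B₂ + 3) - 3 * B₁ * B₃)|

/-- Condition C4. If `B₁ = B₂`, the quotient is `0` in Lean and the condition fails. -/
def C4 (B₁ B₂ : ℝ) : Prop :=
  0 < (2 * B₁ - B₁ ^ 2 - 2 * B₂) / (2 * (B₁ - B₂)) ∧
    (2 * B₁ - B₁ ^ 2 - 2 * B₂) / (2 * (B₁ - B₂)) < 1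

end Sakaguchi

end

/-!
Let `F = φ ∘ ω = 1 + b₁ z + b₂ z² + ⋯` be the quotient attached to `f`. Comparing coefficients in
`(2 z f')' = F · (f(z) - f(-z))'` gives `20 a₅ = b₄ + b₂² / 2`. Written through the function
`p = (1 + ω) / (1 - ω) = 1 + p₁ z + ⋯` of positive real part, this is `B₁ / 2` times a polynomial
`p₄ - q p₁ p₃ - (s / 2) p₂² + C p₁² p₂ + D p₁⁴`, where `q, s, C, D` depend on `B₁, …, B₄` only. The
claim is that this polynomial is at most `2` in absolute value.

The bound is an inequality of Nehari–Netanyahu type. If `w` is a Schwarz function and `|ζ| = 1`,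
then `(1 - ζ w) / (1 + ζ w) = 1 - 2 ζ · w / (1 + ζ w)` has positive real part, so by Carathéodory's
bound every Taylor coefficient of `w / (1 + ζ w)` has modulus at most `1`. The fourth one is a
polynomial of degree `3` in `ζ`. Integrating it against a probability measure on the circle with
moments `ν₁, ν₂, ν₃` gives
`|w₄ - ν₁ (2 w₁ w₃ + w₂²) + 3 ν₂ w₁² w₂ - ν₃ w₁⁴| ≤ 1` (`norm_average_rotation_le`). Such a measure
is supplied by a function of nonnegative real part (`norm_sum_mul_taylorCoeff_le`), and that
function by prescribing its Schur parameters `s₁, s₂, s₃ ∈ (-1, 1)` (`exists_caratheodory`).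

This is applied to the Schwarz function `w` that belongs not to `p` itself but to an average of
rotations of `p`, with coefficients `x p₁, x² p₂, x p₃, p₄` (`exists_average_rotations`). The four
parameters `x, s₁, s₂, s₃` are then determined by `q, s, C, D`, and the conditions C4, C1, C2, C3
say exactly that `x² ∈ (0, 1)` and `|s₁|, |s₂|, |s₃| < 1` (`exists_schur_parameters`).

Equality is attained by a primitive `g` of `h(z) = exp (∫ (φ(z⁴) - 1) / z)`: as `h` is even,
`(g(z) - g(-z))' = 2 h`, while `(2 z g')' = 2 h + 2 z h' = 2 φ(z⁴) h` (`exists_extremal`).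
-/

open Filter Topology Real

namespace Sakaguchi

/-! ### Taylor series at the origin -/

/-- The Taylor series of `f` at the origin, as a formal power series. -/
noncomputable def taylor (f : ℂ → ℂ) : PowerSeries ℂ := PowerSeries.mk (taylorCoeff f)

theorem coeff_taylor (f : ℂ → ℂ) (n : ℕ) : PowerSeries.coeff n (taylor f) = taylorCoeff f n :=
  PowerSeries.coeff_mk _ _

theorem taylorCoeff_zero (f : ℂ → ℂ) : taylorCoeff f 0 = f 0 := by
  simp [taylorCoeff]

theorem taylorCoeff_one (f : ℂ → ℂ) : taylorCoeff f 1 = deriv f 0 := by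
  simp [taylorCoeff, iteratedDeriv_one]

theorem taylorCoeff_deriv (f : ℂ → ℂ) (n : ℕ) :
    taylorCoeff (deriv f) n = (n + 1) * taylorCoeff f (n + 1) := by
  have h : (n.factorial : ℂ) ≠ 0 := by exact_mod_cast n.factorial_ne_zero
  have h' : (n + 1 : ℂ) ≠ 0 := by exact_mod_cast n.succ_ne_zero
  simp only [taylorCoeff, iteratedDeriv_succ', Nat.factorial_succ]
  push_cast
  field_simp

theorem taylor_congr {f g : ℂ → ℂ} (h : f =ᶠ[𝓝 0] g) : taylor f = taylor g := by
  ext n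
  simp only [coeff_taylor, taylorCoeff, (h.iteratedDeriv n).eq_of_nhds]

theorem taylor_const (c : ℂ) : taylor (fun _ => c) = PowerSeries.C c := by
  ext n
  rw [coeff_taylor, PowerSeries.coeff_C]
  rcases n with _ | n <;> simp [taylorCoeff, iteratedDeriv_const]

theorem taylor_id : taylor (fun z => z) = PowerSeries.X := by
  ext n
  rw [coeff_taylor, PowerSeries.coeff_X]
  have := iteratedDeriv_id (𝕜 := ℂ) (n := n) (x := 0)
  simp only [taylorCoeff, show (fun z : ℂ => z) = id from rfl, this]
  rcases n with _ | _ | n <;> simp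

theorem taylor_add {f g : ℂ → ℂ} (hf : AnalyticAt ℂ f 0) (hg : AnalyticAt ℂ g 0) :
    taylor (fun z => f z + g z) = taylor f + taylor g := by
  ext n
  simp only [map_add, coeff_taylor, taylorCoeff]
  rw [← add_div, ← iteratedDeriv_add hf.contDiffAt hg.contDiffAt]
  rfl

theorem taylor_sub {f g : ℂ → ℂ} (hf : AnalyticAt ℂ f 0) (hg : AnalyticAt ℂ g 0) :
    taylor (fun z => f z - g z) = taylor f - taylor g := by
  ext n
  simp only [map_sub, coeff_taylor, taylorCoeff]
  rw [← sub_div, ← iteratedDeriv_sub hf.contDiffAt hg.contDiffAt]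
  rfl

theorem taylor_mul {f g : ℂ → ℂ} (hf : AnalyticAt ℂ f 0) (hg : AnalyticAt ℂ g 0) :
    taylor (fun z => f z * g z) = taylor f * taylor g := by
  ext n
  rw [PowerSeries.coeff_mul, Finset.Nat.sum_antidiagonal_eq_sum_range_succ_mk]
  simp only [coeff_taylor, taylorCoeff]
  have := iteratedDeriv_mul (n := n) hf.contDiffAt hg.contDiffAt
  rw [show (fun z => f z * g z) = f * g from rfl, this, Finset.sum_div]
  refine Finset.sum_congr rfl fun k hk => ?_
  have hk' : k ≤ n := Nat.lt_succ_iff.1 (Finset.mem_range.1 hk)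
  rw [Nat.cast_choose ℂ hk']
  have h1 : (n.factorial : ℂ) ≠ 0 := by exact_mod_cast n.factorial_ne_zero
  have h2 : (k.factorial : ℂ) ≠ 0 := by exact_mod_cast k.factorial_ne_zero
  have h3 : ((n - k).factorial : ℂ) ≠ 0 := by exact_mod_cast (n - k).factorial_ne_zero
  field_simp

/-- One Horner step for the Taylor series of a composition `f ∘ ω` with `ω 0 = 0`, where `K` is the
divided difference `(f z - f 0) / z`. -/
theorem taylor_comp {f ω : ℂ → ℂ} (hf : AnalyticAt ℂ f 0) (hω : AnalyticAt ℂ ω 0) (h0 : ω 0 = 0) :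
    ∃ K : ℂ → ℂ, AnalyticAt ℂ K 0 ∧ (∀ n, taylorCoeff K n = taylorCoeff f (n + 1)) ∧
      taylor (fun z => f (ω z)) =
        PowerSeries.C (f 0) + taylor ω * taylor (fun z => K (ω z)) := by
  have hK : AnalyticAt ℂ (dslope f 0) 0 := by
    obtain ⟨p, hp⟩ := hf
    exact ⟨_, hp.has_fpower_series_dslope_fslope⟩
  have hfK : ∀ z, f z = f 0 + z * dslope f 0 z := fun z => by
    have := sub_smul_dslope f 0 z
    simp only [sub_zero, smul_eq_mul] at this
    rw [this]; ring
  have hKω : AnalyticAt ℂ (fun z => dslope f 0 (ω z)) 0 := by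
    apply AnalyticAt.fun_comp (g := dslope f 0) (f := ω) _ hω
    rwa [h0]
  refine ⟨dslope f 0, hK, fun n => ?_, ?_⟩
  · have : taylor f = PowerSeries.C (f 0) + PowerSeries.X * taylor (dslope f 0) := by
      conv_lhs => rw [funext hfK]
      rw [taylor_add analyticAt_const (by fun_prop), taylor_const,
        taylor_mul (by fun_prop) hK, taylor_id]
    have := congrArg (PowerSeries.coeff (n + 1)) this
    rw [coeff_taylor, map_add, mul_comm, PowerSeries.coeff_succ_mul_X, coeff_taylor,
      PowerSeries.coeff_C] at this
    simpa using this.symm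
  · rw [show (fun z => f (ω z)) = fun z => f 0 + ω z * dslope f 0 (ω z) from
      funext fun z => hfK _, taylor_add analyticAt_const (by fun_prop), taylor_const,
        taylor_mul hω hKω]

theorem taylorCoeff_comp_mul {f : ℂ → ℂ} (hf : AnalyticAt ℂ f 0) (a : ℂ) (n : ℕ) :
    taylorCoeff (fun z => f (a * z)) n = a ^ n * taylorCoeff f n := by
  induction n generalizing f with
  | zero => simp [taylorCoeff_zero]
  | succ n ih =>
    obtain ⟨K, hK, hKf, h⟩ := taylor_comp hf (ω := fun z => a * z) (by fun_prop) (by simp)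
    rw [← coeff_taylor, h, taylor_mul (f := fun _ => a) (g := fun z => z) (by fun_prop)
      (by fun_prop), taylor_const, taylor_id,
      mul_assoc, map_add, PowerSeries.coeff_C, PowerSeries.coeff_C_mul, mul_comm PowerSeries.X,
      PowerSeries.coeff_succ_mul_X, coeff_taylor, ih hK, hKf]
    simp [pow_succ']
    ring

/-- The coefficients of a composition `f ∘ ω` with `ω 0 = 0`, up to the fourth order. -/
theorem taylorCoeff_comp {f ω : ℂ → ℂ} (hf : AnalyticAt ℂ f 0) (hω : AnalyticAt ℂ ω 0)
    (h0 : ω 0 = 0) :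
    taylorCoeff (fun z => f (ω z)) 1 = taylorCoeff f 1 * taylorCoeff ω 1 ∧
    taylorCoeff (fun z => f (ω z)) 2 =
      taylorCoeff f 1 * taylorCoeff ω 2 + taylorCoeff f 2 * taylorCoeff ω 1 ^ 2 ∧
    taylorCoeff (fun z => f (ω z)) 3 =
      taylorCoeff f 1 * taylorCoeff ω 3 + taylorCoeff f 2 * (2 * taylorCoeff ω 1 * taylorCoeff ω 2)
        + taylorCoeff f 3 * taylorCoeff ω 1 ^ 3 ∧
    taylorCoeff (fun z => f (ω z)) 4 =
      taylorCoeff f 1 * taylorCoeff ω 4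
        + taylorCoeff f 2 * (2 * taylorCoeff ω 1 * taylorCoeff ω 3 + taylorCoeff ω 2 ^ 2)
        + taylorCoeff f 3 * (3 * taylorCoeff ω 1 ^ 2 * taylorCoeff ω 2)
        + taylorCoeff f 4 * taylorCoeff ω 1 ^ 4 := by
  obtain ⟨K₁, hK₁, hc₁, h₁⟩ := taylor_comp hf hω h0
  obtain ⟨K₂, hK₂, hc₂, h₂⟩ := taylor_comp hK₁ hω h0
  obtain ⟨K₃, hK₃, hc₃, h₃⟩ := taylor_comp hK₂ hω h0
  obtain ⟨K₄, hK₄, hc₄, h₄⟩ := taylor_comp hK₃ hω h0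
  have hω0 : taylorCoeff ω 0 = 0 := by rw [taylorCoeff_zero, h0]
  have e₁ : K₁ 0 = taylorCoeff f 1 := by rw [← taylorCoeff_zero K₁, hc₁]
  have e₂ : K₂ 0 = taylorCoeff f 2 := by rw [← taylorCoeff_zero K₂, hc₂, hc₁]
  have e₃ : K₃ 0 = taylorCoeff f 3 := by rw [← taylorCoeff_zero K₃, hc₃, hc₂, hc₁]
  have e₄ : K₄ 0 = taylorCoeff f 4 := by rw [← taylorCoeff_zero K₄, hc₄, hc₃, hc₂, hc₁]
  have e₄' : taylorCoeff (fun z => K₄ (ω z)) 0 = taylorCoeff f 4 := by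
    rw [taylorCoeff_zero, h0, e₄]
  rw [h₄, e₃] at h₃
  rw [h₃, e₂] at h₂
  rw [h₂, e₁] at h₁
  refine ⟨?_, ?_, ?_, ?_⟩ <;>
  · rw [← coeff_taylor, h₁]
    simp [PowerSeries.coeff_mul, Finset.Nat.antidiagonal_succ, coeff_taylor, hω0, e₄',
      PowerSeries.coeff_C]
    try ring

/-! ### Fourier coefficients of the real part and Carathéodory's bound -/

/-- Cauchy's formula for the Taylor coefficients, as a circle average. -/
theorem taylorCoeff_eq_circleAverage {f : ℂ → ℂ} {r : ℝ} (hr : 0 < r)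
    (hf : DifferentiableOn ℂ f (Metric.closedBall 0 r)) (n : ℕ) :
    taylorCoeff f n = circleAverage (fun z => (z ^ n)⁻¹ * f z) 0 r := by
  lift r to NNReal using hr.le
  have hr' : (0 : NNReal) < r := by exact_mod_cast hr
  have h := (hf.hasFPowerSeriesOnBall hr').factorial_smul 1 n
  rw [cauchyPowerSeries_apply, ← iteratedDeriv_eq_iteratedFDeriv] at h
  have hn : (n.factorial : ℂ) ≠ 0 := by exact_mod_cast n.factorial_ne_zero
  rw [circleAverage_eq_circleIntegral hr.ne', taylorCoeff, ← h, nsmul_eq_mul,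
    mul_div_cancel_left₀ _ hn]
  congr 2
  ext z
  simp
  ring

/-- For `n ≥ 1`, the average of `z⁻ⁿ · Re f(z)` over a circle around the origin is half the `n`-th
Taylor coefficient of `f`: the half of `Re f` that comes from the conjugate of `f` averages
to `0`. -/
theorem circleAverage_re {f : ℂ → ℂ} {r : ℝ} (hr : 0 < r)
    (hf : DifferentiableOn ℂ f (Metric.closedBall 0 r)) (n : ℕ) :
    circleAverage (fun z => (z ^ n)⁻¹ * ((f z).re : ℂ)) 0 r =
      if n = 0 then ((f 0).re : ℂ) else taylorCoeff f n / 2 := by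
  have hci : ∀ g : ℂ → ℂ, ContinuousOn g (Metric.sphere 0 r) → CircleIntegrable g 0 r :=
    fun g hg => hg.circleIntegrable hr.le
  have hne : ∀ z ∈ Metric.sphere (0 : ℂ) r, z ^ n ≠ 0 := fun z hz => by
    have : z ≠ 0 := by
      rintro rfl
      simp at hz
      exact hr.ne hz
    exact pow_ne_zero _ this
  have hfc : ContinuousOn f (Metric.sphere 0 r) :=
    hf.continuousOn.mono Metric.sphere_subset_closedBall
  have h1 : CircleIntegrable (fun z => z ^ n * f z) 0 r :=
    hci _ (by fun_prop)
  have h2 : CircleIntegrable (fun z => (z ^ n)⁻¹ * f z) 0 r :=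
    hci _ ((continuousOn_id.pow n).inv₀ hne |>.mul hfc)
  -- The average of the holomorphic function `z ^ n * f z` is its value at the centre.
  have key1 : circleAverage (fun z => z ^ n * f z) 0 r = 0 ^ n * f 0 := by
    have hd : DifferentiableOn ℂ (fun z => z ^ n * f z) (Metric.closedBall 0 |r|) := by
      rw [abs_of_pos hr]; fun_prop
    exact (hd.diffContOnCl_ball (le_refl _)).circleAverage
  -- Conjugation turns it into the average of `z ^ (-n) * conj (f z)`.
  have key2 : circleAverage (fun z => (starRingEnd ℂ) (z ^ n * f z)) 0 r =
      (starRingEnd ℂ) (0 ^ n * f 0) := by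
    rw [← key1]
    exact (Complex.conjCLE : ℂ →L[ℝ] ℂ).circleAverage_comp_comm h1
  have h3 : CircleIntegrable (fun z => (starRingEnd ℂ) (z ^ n * f z)) 0 r :=
    hci _ (Complex.continuous_conj.comp_continuousOn (by fun_prop))
  have h4 : circleAverage (fun z => (z ^ n)⁻¹ * ((f z).re : ℂ)) 0 r =
      circleAverage (fun z => (1 / 2 : ℂ) • ((z ^ n)⁻¹ * f z) +
        (((r : ℂ) ^ (2 * n))⁻¹ / 2) • (starRingEnd ℂ) (z ^ n * f z)) 0 r := by
    apply circleAverage_congr_sphere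
    intro z hz
    rw [abs_of_pos hr] at hz
    have hz' : z * (starRingEnd ℂ) z = (r : ℂ) ^ 2 := by
      rw [Complex.mul_conj, Complex.normSq_eq_norm_sq]
      simp only [mem_sphere_iff_norm, sub_zero] at hz
      rw [hz]; push_cast; rfl
    have hzn := hne z hz
    have hr0 : (r : ℂ) ≠ 0 := by exact_mod_cast hr.ne'
    -- On the circle, `conj z = r ^ 2 / z`.
    have e : ((r : ℂ) ^ (2 * n))⁻¹ * (starRingEnd ℂ) z ^ n = (z ^ n)⁻¹ := by
      rw [pow_mul, ← hz', mul_pow]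
      have : (starRingEnd ℂ) z ^ n ≠ 0 := by
        rw [← map_pow]; simpa using hzn
      field_simp
    have e2 : ((f z).re : ℂ) = (f z + (starRingEnd ℂ) (f z)) / 2 := by
      rw [Complex.re_eq_add_conj]
    simp only [smul_eq_mul, map_mul, map_pow]
    rw [e2, show ((r : ℂ) ^ (2 * n))⁻¹ / 2 * ((starRingEnd ℂ) z ^ n * (starRingEnd ℂ) (f z)) =
      (((r : ℂ) ^ (2 * n))⁻¹ * (starRingEnd ℂ) z ^ n) * (starRingEnd ℂ) (f z) / 2 by ring, e]
    ring
  rw [h4, circleAverage_fun_add (CircleIntegrable.const_fun_smul h2)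
    (CircleIntegrable.const_fun_smul h3), circleAverage_fun_smul,
    circleAverage_fun_smul, key2, ← taylorCoeff_eq_circleAverage hr hf]
  rcases eq_or_ne n 0 with rfl | hn
  · simp [taylorCoeff_zero, Complex.re_eq_add_conj]
    ring
  · simp [hn]
    ring

/-- **Carathéodory–Toeplitz pairing.** Let `P` be holomorphic with nonnegative real part on the
disk and `P 0 = 1`, so that `1, a₁ / 2, a₂ / 2, …` are the moments of a probability measure on the
unit circle. Integrating against it a trigonometric polynomial bounded by `1` yields a number
bounded by `1`. -/
theorem norm_sum_mul_taylorCoeff_le {P : ℂ → ℂ} (hP : DifferentiableOn ℂ P disk)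
    (hre : ∀ z ∈ disk, 0 ≤ (P z).re) (h0 : P 0 = 1) (N : ℕ) (t : ℕ → ℂ)
    (ht : ∀ ζ : ℂ, ‖ζ‖ = 1 → ‖∑ k ∈ Finset.range N, t k * ζ ^ k‖ ≤ 1) :
    ‖∑ k ∈ Finset.range N, t k * (if k = 0 then 1 else taylorCoeff P k / 2)‖ ≤ 1 := by
  set m : ℕ → ℂ := fun k => if k = 0 then 1 else taylorCoeff P k / 2 with hm
  -- On the circle of radius `r < 1` the `k`-th moment carries an extra factor `r ^ k`.
  have key : ∀ r : ℝ, 0 < r → r < 1 →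
      ‖∑ k ∈ Finset.range N, t k * ((r : ℂ) ^ k * m k)‖ ≤ 1 := by
    intro r hr hr1
    have hsub : Metric.closedBall (0 : ℂ) r ⊆ disk := Metric.closedBall_subset_ball hr1
    have hPr := hP.mono hsub
    have hPc : ContinuousOn P (Metric.sphere 0 r) :=
      hPr.continuousOn.mono Metric.sphere_subset_closedBall
    have hRe : ContinuousOn (fun z => (P z).re) (Metric.sphere 0 r) :=
      Complex.continuous_re.comp_continuousOn hPc
    have hRe' : ContinuousOn (fun z => ((P z).re : ℂ)) (Metric.sphere 0 r) :=
      Complex.continuous_ofReal.comp_continuousOn hRe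
    have hne : ∀ z ∈ Metric.sphere (0 : ℂ) r, z ≠ 0 := fun z hz => by
      rintro rfl
      simp at hz
      exact hr.ne hz
    have hcont : ∀ k, ContinuousOn (fun z : ℂ => (z ^ k)⁻¹) (Metric.sphere 0 r) := fun k =>
      (continuousOn_id.pow k).inv₀ fun z hz => pow_ne_zero _ (hne z hz)
    have hav : ∀ k, circleAverage (fun z => (z ^ k)⁻¹ * ((P z).re : ℂ)) 0 r = m k := fun k => by
      rw [circleAverage_re hr hPr, hm, h0]
      simp
    have hsum : ∑ k ∈ Finset.range N, t k * ((r : ℂ) ^ k * m k) =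
        circleAverage (fun z => ∑ k ∈ Finset.range N,
          (t k * (r : ℂ) ^ k) • ((z ^ k)⁻¹ * ((P z).re : ℂ))) 0 r := by
      rw [circleAverage_fun_sum]
      · refine Finset.sum_congr rfl fun k _ => ?_
        rw [circleAverage_fun_smul, hav, smul_eq_mul, mul_assoc]
      · intro k _
        exact ContinuousOn.circleIntegrable hr.le
          (ContinuousOn.fun_const_smul ((hcont k).fun_mul hRe') (t k * (r : ℂ) ^ k))
    have hone : circleAverage (fun z => (P z).re) 0 r = 1 := by
      have h := hav 0
      have hi : CircleIntegrable (fun z => ((P z).re : ℂ)) 0 r := hRe'.circleIntegrable hr.le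
      have h' := (Complex.reCLM : ℂ →L[ℝ] ℝ).circleAverage_comp_comm hi
      simp only [pow_zero, inv_one, one_mul, hm, if_true] at h
      rw [h] at h'
      simpa [Function.comp_def] using h'
    rw [hsum]
    refine le_trans ?_ hone.le
    rw [circleAverage_def, circleAverage_def, norm_smul, smul_eq_mul, norm_inv, norm_of_nonneg
      (by positivity : (0 : ℝ) ≤ 2 * π)]
    refine mul_le_mul_of_nonneg_left ?_ (by positivity)
    refine intervalIntegral.norm_integral_le_of_norm_le (by positivity) ?_ ?_
    · refine Eventually.of_forall fun θ _ => ?_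
      set z := circleMap 0 r θ with hz
      have hzs : z ∈ Metric.sphere (0 : ℂ) r := circleMap_mem_sphere 0 hr.le θ
      have hz0 := hne z hzs
      have hzn : ‖z‖ = r := by simpa using hzs
      have hzd : z ∈ disk := hsub (Metric.sphere_subset_closedBall hzs)
      have e : ∑ k ∈ Finset.range N, (t k * (r : ℂ) ^ k) • ((z ^ k)⁻¹ * ((P z).re : ℂ)) =
          (∑ k ∈ Finset.range N, t k * ((r : ℂ) / z) ^ k) * ((P z).re : ℂ) := by
        rw [Finset.sum_mul]
        refine Finset.sum_congr rfl fun k _ => ?_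
        rw [smul_eq_mul, div_pow]
        ring
      rw [e, norm_mul, Complex.norm_real, norm_of_nonneg (hre z hzd)]
      refine mul_le_of_le_one_left (hre z hzd) (ht _ ?_)
      rw [norm_div, hzn, Complex.norm_real, norm_of_nonneg hr.le, div_self hr.ne']
    · exact (hRe.circleIntegrable hr.le)
  have hlim : Tendsto (fun r : ℝ => ‖∑ k ∈ Finset.range N, t k * ((r : ℂ) ^ k * m k)‖)
      (𝓝[<] 1) (𝓝 ‖∑ k ∈ Finset.range N, t k * m k‖) := by
    have hc : Continuous fun r : ℝ => ‖∑ k ∈ Finset.range N, t k * ((r : ℂ) ^ k * m k)‖ := by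
      fun_prop
    have := (hc.tendsto 1).mono_left (nhdsWithin_le_nhds (s := Set.Iio 1))
    simpa using this
  refine le_of_tendsto hlim ?_
  filter_upwards [Ioo_mem_nhdsLT (zero_lt_one' ℝ)] with r hr using key r hr.1 hr.2

/-- **Carathéodory's bound** for the Taylor coefficients of a function with nonnegative real
part. -/
theorem norm_taylorCoeff_le_two {P : ℂ → ℂ} (hP : DifferentiableOn ℂ P disk)
    (hre : ∀ z ∈ disk, 0 ≤ (P z).re) (h0 : P 0 = 1) {n : ℕ} (hn : n ≠ 0) :
    ‖taylorCoeff P n‖ ≤ 2 := by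
  have h := norm_sum_mul_taylorCoeff_le hP hre h0 (n + 1) (fun k => if k = n then 1 else 0)
    (fun ζ hζ => by simp [hζ])
  rw [Finset.sum_eq_single n (by simp +contextual) (by simp)] at h
  simp [hn] at h
  linarith

/-! ### The Schur algorithm -/

theorem zero_mem_disk : (0 : ℂ) ∈ disk := Metric.mem_ball_self one_pos

theorem mem_disk {z : ℂ} : z ∈ disk ↔ ‖z‖ < 1 := by simp [disk]

theorem disk_mem_nhds {z : ℂ} (hz : z ∈ disk) : disk ∈ 𝓝 z := Metric.isOpen_ball.mem_nhds hz

theorem analyticAt_of_differentiableOn {f : ℂ → ℂ} (hf : DifferentiableOn ℂ f disk) {z : ℂ}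
    (hz : z ∈ disk) : AnalyticAt ℂ f z :=
  hf.analyticAt (disk_mem_nhds hz)

theorem one_add_ne_zero_of_norm_lt {u : ℂ} (hu : ‖u‖ < 1) : 1 + u ≠ 0 := by
  intro h
  have : u = -1 := by linear_combination h
  rw [this] at hu
  simp at hu

theorem one_sub_ne_zero_of_norm_lt {u : ℂ} (hu : ‖u‖ < 1) : 1 - u ≠ 0 := by
  rw [sub_eq_add_neg]
  exact one_add_ne_zero_of_norm_lt (by rwa [norm_neg])

theorem re_one_add_div_one_sub_pos {u : ℂ} (hu : ‖u‖ < 1) : 0 < ((1 + u) / (1 - u)).re := by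
  have hne := one_sub_ne_zero_of_norm_lt hu
  have h1 : 0 < Complex.normSq (1 - u) := Complex.normSq_pos.2 hne
  rw [Complex.div_re, ← add_div]
  refine div_pos ?_ h1
  have h2 : u.re ^ 2 + u.im ^ 2 < 1 := by
    have := Complex.normSq_eq_norm_sq u
    rw [Complex.normSq_apply] at this
    nlinarith [norm_nonneg u]
  simp
  nlinarith

theorem norm_sub_one_div_add_one_lt {p : ℂ} (hp : 0 < p.re) : ‖(p - 1) / (p + 1)‖ < 1 := by
  have hne : p + 1 ≠ 0 := by
    intro h
    have := congrArg Complex.re h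
    simp at this
    linarith
  rw [norm_div, div_lt_one (norm_pos_iff.2 hne)]
  refine lt_of_pow_lt_pow_left₀ 2 (norm_nonneg _) ?_
  rw [← Complex.normSq_eq_norm_sq, ← Complex.normSq_eq_norm_sq, Complex.normSq_apply,
    Complex.normSq_apply]
  simp
  nlinarith

theorem norm_add_div_one_add_mul_le {s : ℝ} (hs : |s| < 1) {u : ℂ} (hu : ‖u‖ ≤ 1) :
    ‖((s : ℂ) + u) / (1 + s * u)‖ ≤ 1 := by
  rw [norm_div]
  refine div_le_one_of_le₀ ?_ (norm_nonneg _)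
  refine le_of_sq_le_sq ?_ (norm_nonneg _)
  rw [← Complex.normSq_eq_norm_sq, ← Complex.normSq_eq_norm_sq, Complex.normSq_apply,
    Complex.normSq_apply]
  have h2 : u.re ^ 2 + u.im ^ 2 ≤ 1 := by
    have := Complex.normSq_eq_norm_sq u
    rw [Complex.normSq_apply] at this
    nlinarith [norm_nonneg u]
  have h3 : s ^ 2 < 1 := (sq_lt_one_iff_abs_lt_one s).2 hs
  simp
  nlinarith [mul_nonneg (sub_nonneg.2 h3.le) (sub_nonneg.2 h2)]

/-- One step of the inverse Schur algorithm: from a function `g` bounded by `1` and a parameter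
`s ∈ (-1, 1)` to the function `f = (s + z g) / (1 + s z g)`, bounded by `1` and with `f 0 = s`. -/
theorem exists_schur_step {s : ℝ} (hs : |s| < 1) {g : ℂ → ℂ} (hg : DifferentiableOn ℂ g disk)
    (hb : ∀ z ∈ disk, ‖g z‖ ≤ 1) :
    ∃ f : ℂ → ℂ, DifferentiableOn ℂ f disk ∧ (∀ z ∈ disk, ‖f z‖ ≤ 1) ∧
      taylorCoeff f 0 = s ∧
      taylorCoeff f 1 = (1 - (s : ℂ) ^ 2) * taylorCoeff g 0 ∧
      taylorCoeff f 2 = (1 - (s : ℂ) ^ 2) * (taylorCoeff g 1 - s * taylorCoeff g 0 ^ 2) := by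
  have hzg : ∀ z ∈ disk, ‖z * g z‖ < 1 := fun z hz => by
    rw [norm_mul]
    exact (mul_le_of_le_one_right (norm_nonneg _) (hb z hz)).trans_lt (mem_disk.1 hz)
  have hne : ∀ z ∈ disk, 1 + (s : ℂ) * (z * g z) ≠ 0 := fun z hz => by
    refine one_add_ne_zero_of_norm_lt ?_
    rw [norm_mul, Complex.norm_real]
    exact mul_lt_one_of_nonneg_of_lt_one_left (norm_nonneg _) hs (hzg z hz).le
  have hf : DifferentiableOn ℂ (fun z => ((s : ℂ) + z * g z) / (1 + s * (z * g z))) disk :=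
    DifferentiableOn.div (by fun_prop) (by fun_prop) hne
  refine ⟨_, hf, fun z hz => norm_add_div_one_add_mul_le hs (hzg z hz).le, ?_⟩
  set f : ℂ → ℂ := fun z => ((s : ℂ) + z * g z) / (1 + s * (z * g z)) with hfdef
  have hga := analyticAt_of_differentiableOn hg zero_mem_disk
  have hfa := analyticAt_of_differentiableOn hf zero_mem_disk
  have hmul : taylor f * (1 + PowerSeries.C (s : ℂ) * (PowerSeries.X * taylor g)) =
      PowerSeries.C (s : ℂ) + PowerSeries.X * taylor g := by
    have e1 : taylor (fun z => f z * (1 + s * (z * g z))) = taylor (fun z => s + z * g z) := by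
      apply taylor_congr
      filter_upwards [disk_mem_nhds zero_mem_disk] with z hz
      exact div_mul_cancel₀ _ (hne z hz)
    rwa [taylor_mul hfa (by fun_prop), taylor_add (by fun_prop) (by fun_prop),
      taylor_add (by fun_prop) (by fun_prop), taylor_mul (by fun_prop) (by fun_prop),
      taylor_mul (by fun_prop) hga, taylor_const, taylor_const, taylor_id, map_one] at e1
  have h0 := congrArg (PowerSeries.coeff 0) hmul
  have h1 := congrArg (PowerSeries.coeff 1) hmul
  have h2 := congrArg (PowerSeries.coeff 2) hmul
  simp [PowerSeries.coeff_mul, Finset.Nat.antidiagonal_succ, coeff_taylor,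
      PowerSeries.coeff_C, PowerSeries.coeff_X, PowerSeries.coeff_one] at h0 h1 h2
  rw [h0] at h1 h2
  refine ⟨h0, by linear_combination h1, ?_⟩
  linear_combination h2 - s * taylorCoeff g 0 * h1

/-- Prescribed Schur parameters `s₁, s₂, s₃ ∈ (-1, 1)` belong to a Carathéodory function. -/
theorem exists_caratheodory {s₁ s₂ s₃ : ℝ} (h₁ : |s₁| < 1) (h₂ : |s₂| < 1) (h₃ : |s₃| < 1) :
    ∃ P : ℂ → ℂ, DifferentiableOn ℂ P disk ∧ (∀ z ∈ disk, 0 ≤ (P z).re) ∧ P 0 = 1 ∧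
      taylorCoeff P 1 / 2 = s₁ ∧
      taylorCoeff P 2 / 2 = (1 - (s₁ : ℂ) ^ 2) * s₂ + (s₁ : ℂ) ^ 2 ∧
      taylorCoeff P 3 / 2 =
        (1 - (s₁ : ℂ) ^ 2) * ((1 - (s₂ : ℂ) ^ 2) * s₃ - s₁ * (s₂ : ℂ) ^ 2)
          + 2 * s₁ * (1 - (s₁ : ℂ) ^ 2) * s₂ + (s₁ : ℂ) ^ 3 := by
  obtain ⟨g, hg, hgb, hg0, hg1, -⟩ := exists_schur_step h₂ (g := fun _ => (s₃ : ℂ))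
    (differentiableOn_const _) (fun z _ => by simpa using h₃.le)
  obtain ⟨f, hf, hfb, hf0, hf1, hf2⟩ := exists_schur_step h₁ hg hgb
  rw [taylorCoeff_zero] at hg1
  rw [hg0] at hf1 hf2
  rw [hg1] at hf2
  have hzf : ∀ z ∈ disk, ‖z * f z‖ < 1 := fun z hz => by
    rw [norm_mul]
    exact (mul_le_of_le_one_right (norm_nonneg _) (hfb z hz)).trans_lt (mem_disk.1 hz)
  have hne : ∀ z ∈ disk, 1 - z * f z ≠ 0 := fun z hz => one_sub_ne_zero_of_norm_lt (hzf z hz)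
  have hP : DifferentiableOn ℂ (fun z => (1 + z * f z) / (1 - z * f z)) disk :=
    DifferentiableOn.div (by fun_prop) (by fun_prop) hne
  refine ⟨_, hP, fun z hz => (re_one_add_div_one_sub_pos (hzf z hz)).le, by simp, ?_⟩
  set P : ℂ → ℂ := fun z => (1 + z * f z) / (1 - z * f z) with hPdef
  have hfa := analyticAt_of_differentiableOn hf zero_mem_disk
  have hPa := analyticAt_of_differentiableOn hP zero_mem_disk
  have hmul : taylor P * (1 - PowerSeries.X * taylor f) = 1 + PowerSeries.X * taylor f := by
    have e1 : taylor (fun z => P z * (1 - z * f z)) = taylor (fun z => 1 + z * f z) := by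
      apply taylor_congr
      filter_upwards [disk_mem_nhds zero_mem_disk] with z hz
      exact div_mul_cancel₀ _ (hne z hz)
    rwa [taylor_mul hPa (by fun_prop), taylor_add (by fun_prop) (by fun_prop),
      taylor_sub (by fun_prop) (by fun_prop),
      taylor_mul (by fun_prop) hfa, taylor_const, taylor_id, map_one] at e1
  have h0 := congrArg (PowerSeries.coeff 0) hmul
  have h1 := congrArg (PowerSeries.coeff 1) hmul
  have h2 := congrArg (PowerSeries.coeff 2) hmul
  have h3 := congrArg (PowerSeries.coeff 3) hmul
  simp [PowerSeries.coeff_mul, Finset.Nat.antidiagonal_succ, coeff_taylor,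
    PowerSeries.coeff_X, PowerSeries.coeff_one] at h0 h1 h2 h3
  rw [h0, hf0] at h1
  have e1 : taylorCoeff P 1 = 2 * s₁ := by linear_combination h1
  rw [h0, hf0, hf1, e1] at h2
  have e2 : taylorCoeff P 2 = 2 * ((1 - (s₁ : ℂ) ^ 2) * s₂ + (s₁ : ℂ) ^ 2) := by
    linear_combination h2
  rw [h0, hf0, hf1, hf2, e1, e2] at h3
  refine ⟨by rw [e1]; ring, by rw [e2]; ring, by linear_combination h3 / 2⟩

/-! ### A Nehari–Netanyahu inequality -/

/-- The fourth Taylor coefficient of `w / (1 + ζ w)`, a polynomial in `ζ`, is bounded by `1` on the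
unit circle, since `1 - 2 ζ w / (1 + ζ w)` has positive real part. -/
theorem norm_taylorCoeff_four_rotation_le {w : ℂ → ℂ} (hw : IsSchwarz w) {ζ : ℂ} (hζ : ‖ζ‖ = 1) :
    ‖taylorCoeff w 4 - (2 * taylorCoeff w 1 * taylorCoeff w 3 + taylorCoeff w 2 ^ 2) * ζ
      + 3 * taylorCoeff w 1 ^ 2 * taylorCoeff w 2 * ζ ^ 2 - taylorCoeff w 1 ^ 4 * ζ ^ 3‖ ≤ 1 := by
  have hb : ∀ z ∈ disk, ‖-(ζ * w z)‖ < 1 := fun z hz => by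
    rw [norm_neg, norm_mul, hζ, one_mul]
    exact mem_disk.1 (hw.maps hz)
  have hwd := hw.holo
  have hne : ∀ z ∈ disk, 1 - -(ζ * w z) ≠ 0 := fun z hz => one_sub_ne_zero_of_norm_lt (hb z hz)
  have hQ : DifferentiableOn ℂ (fun z => (1 + -(ζ * w z)) / (1 - -(ζ * w z))) disk :=
    DifferentiableOn.div (by fun_prop) (by fun_prop) hne
  have hbound := norm_taylorCoeff_le_two hQ
    (fun z hz => (re_one_add_div_one_sub_pos (hb z hz)).le) (by simp [hw.map_zero]) four_ne_zero
  set Q : ℂ → ℂ := fun z => (1 + -(ζ * w z)) / (1 - -(ζ * w z)) with hQdef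
  have hwa := analyticAt_of_differentiableOn hwd zero_mem_disk
  have hQa := analyticAt_of_differentiableOn hQ zero_mem_disk
  have hw0 : taylorCoeff w 0 = 0 := by rw [taylorCoeff_zero, hw.map_zero]
  have hmul : taylor Q * (1 + PowerSeries.C ζ * taylor w) = 1 - PowerSeries.C ζ * taylor w := by
    have e1 : taylor (fun z => Q z * (1 + ζ * w z)) = taylor (fun z => 1 - ζ * w z) := by
      apply taylor_congr
      filter_upwards [disk_mem_nhds zero_mem_disk] with z hz
      have := div_mul_cancel₀ (1 + -(ζ * w z)) (hne z hz)
      rw [sub_neg_eq_add] at this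
      simpa [hQdef, sub_eq_add_neg] using this
    rwa [taylor_mul hQa (by fun_prop), taylor_add (by fun_prop) (by fun_prop),
      taylor_sub (by fun_prop) (by fun_prop), taylor_mul (by fun_prop) hwa, taylor_const,
      taylor_const, map_one] at e1
  have h0 : taylorCoeff Q 0 = 1 := by rw [taylorCoeff_zero]; simp [hQdef, hw.map_zero]
  have h1 := congrArg (PowerSeries.coeff 1) hmul
  have h2 := congrArg (PowerSeries.coeff 2) hmul
  have h3 := congrArg (PowerSeries.coeff 3) hmul
  have h4 := congrArg (PowerSeries.coeff 4) hmul
  simp [PowerSeries.coeff_mul, Finset.Nat.antidiagonal_succ, coeff_taylor,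
    PowerSeries.coeff_C, PowerSeries.coeff_one, hw0] at h1 h2 h3 h4
  rw [h0] at h1
  have e1 : taylorCoeff Q 1 = -2 * ζ * taylorCoeff w 1 := by linear_combination h1
  rw [h0, e1] at h2
  have e2 : taylorCoeff Q 2 = -2 * ζ * taylorCoeff w 2 + 2 * ζ ^ 2 * taylorCoeff w 1 ^ 2 := by
    linear_combination h2
  rw [h0, e1, e2] at h3
  have e3 : taylorCoeff Q 3 = -2 * ζ * taylorCoeff w 3
      + 4 * ζ ^ 2 * taylorCoeff w 1 * taylorCoeff w 2 - 2 * ζ ^ 3 * taylorCoeff w 1 ^ 3 := by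
    linear_combination h3
  rw [h0, e1, e2, e3] at h4
  have e4 : taylorCoeff Q 4 = (-2 * ζ) * (taylorCoeff w 4
      - (2 * taylorCoeff w 1 * taylorCoeff w 3 + taylorCoeff w 2 ^ 2) * ζ
      + 3 * taylorCoeff w 1 ^ 2 * taylorCoeff w 2 * ζ ^ 2 - taylorCoeff w 1 ^ 4 * ζ ^ 3) := by
    linear_combination h4
  rw [e4, norm_mul, norm_mul, hζ] at hbound
  norm_num at hbound
  linarith

/-- The **Nehari–Netanyahu inequality** for the fourth coefficient: averaging the fourth
coefficient of `w / (1 + ζ w)` over `ζ` against the probability measure of a Carathéodory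
function. -/
theorem norm_average_rotation_le {w : ℂ → ℂ} (hw : IsSchwarz w) {P : ℂ → ℂ}
    (hP : DifferentiableOn ℂ P disk) (hre : ∀ z ∈ disk, 0 ≤ (P z).re) (h0 : P 0 = 1) :
    ‖taylorCoeff w 4
      - (2 * taylorCoeff w 1 * taylorCoeff w 3 + taylorCoeff w 2 ^ 2) * (taylorCoeff P 1 / 2)
      + 3 * taylorCoeff w 1 ^ 2 * taylorCoeff w 2 * (taylorCoeff P 2 / 2)
      - taylorCoeff w 1 ^ 4 * (taylorCoeff P 3 / 2)‖ ≤ 1 := by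
  set t : ℕ → ℂ := fun k => match k with
    | 0 => taylorCoeff w 4
    | 1 => -(2 * taylorCoeff w 1 * taylorCoeff w 3 + taylorCoeff w 2 ^ 2)
    | 2 => 3 * taylorCoeff w 1 ^ 2 * taylorCoeff w 2
    | _ => -taylorCoeff w 1 ^ 4 with ht
  have h := norm_sum_mul_taylorCoeff_le hP hre h0 4 t fun ζ hζ => by
    refine le_of_eq_of_le ?_ (norm_taylorCoeff_four_rotation_le hw hζ)
    simp only [Finset.sum_range_succ, Finset.sum_range_zero, ht]
    congr 1
    ring
  refine le_of_eq_of_le ?_ h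
  simp only [Finset.sum_range_succ, Finset.sum_range_zero, ht]
  congr 1
  norm_num
  ring

/-- Multiplying the coefficients `p₁, p₂, p₃, p₄` of a function of positive real part by
`x, x², x, 1` keeps the real part positive: these factors are the Fourier coefficients of the
probability measure with masses `(1 + x)² / 4, (1 - x²) / 4, (1 - x)² / 4, (1 - x²) / 4` at
`1, i, -1, -i`, and the new function is the corresponding average of rotations of `p`. -/
theorem exists_average_rotations {p : ℂ → ℂ} (hp : DifferentiableOn ℂ p disk)
    (hre : ∀ z ∈ disk, 0 < (p z).re) (h0 : p 0 = 1) {x : ℝ} (hx0 : 0 ≤ x) (hx1 : x < 1) :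
    ∃ q : ℂ → ℂ, DifferentiableOn ℂ q disk ∧ (∀ z ∈ disk, 0 < (q z).re) ∧ q 0 = 1 ∧
      taylorCoeff q 1 = x * taylorCoeff p 1 ∧ taylorCoeff q 2 = x ^ 2 * taylorCoeff p 2 ∧
      taylorCoeff q 3 = x * taylorCoeff p 3 ∧ taylorCoeff q 4 = taylorCoeff p 4 := by
  have hrot : ∀ a : ℂ, ‖a‖ = 1 → ∀ z ∈ disk, a * z ∈ disk := fun a ha z hz => by
    rw [mem_disk, norm_mul, ha, one_mul]
    exact mem_disk.1 hz
  have hd : ∀ a : ℂ, ‖a‖ = 1 → DifferentiableOn ℂ (fun z => p (a * z)) disk := fun a ha =>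
    hp.comp (by fun_prop) (hrot a ha)
  have hpa := analyticAt_of_differentiableOn hp zero_mem_disk
  have n0 : ‖(1 : ℂ)‖ = 1 := by simp
  have n1 : ‖Complex.I‖ = 1 := by simp
  have n2 : ‖(-1 : ℂ)‖ = 1 := by simp
  have n3 : ‖-Complex.I‖ = 1 := by simp
  have d0 := hd _ n0
  have d1 := hd _ n1
  have d2 := hd _ n2
  have d3 := hd _ n3
  have a0 := analyticAt_of_differentiableOn d0 zero_mem_disk
  have a1 := analyticAt_of_differentiableOn d1 zero_mem_disk
  have a2 := analyticAt_of_differentiableOn d2 zero_mem_disk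
  have a3 := analyticAt_of_differentiableOn d3 zero_mem_disk
  set m₀ : ℝ := (1 + x) ^ 2 / 4 with hm₀
  set m₁ : ℝ := (1 - x ^ 2) / 4 with hm₁
  set m₂ : ℝ := (1 - x) ^ 2 / 4 with hm₂
  have b0 := (analyticAt_const (v := (m₀ : ℂ))).fun_mul a0
  have b1 := (analyticAt_const (v := (m₁ : ℂ))).fun_mul a1
  have b2 := (analyticAt_const (v := (m₂ : ℂ))).fun_mul a2
  have b3 := (analyticAt_const (v := (m₁ : ℂ))).fun_mul a3
  have hcoeff : ∀ n, taylorCoeff (fun z => (m₀ : ℂ) * p (1 * z) + m₁ * p (Complex.I * z)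
      + m₂ * p (-1 * z) + m₁ * p (-Complex.I * z)) n =
      (m₀ + m₁ * Complex.I ^ n + m₂ * (-1) ^ n + m₁ * (-Complex.I) ^ n) * taylorCoeff p n := by
    intro n
    have e : taylor (fun z => (m₀ : ℂ) * p (1 * z) + m₁ * p (Complex.I * z)
        + m₂ * p (-1 * z) + m₁ * p (-Complex.I * z)) =
        PowerSeries.C (m₀ : ℂ) * taylor (fun z => p (1 * z))
        + PowerSeries.C (m₁ : ℂ) * taylor (fun z => p (Complex.I * z))
        + PowerSeries.C (m₂ : ℂ) * taylor (fun z => p (-1 * z))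
        + PowerSeries.C (m₁ : ℂ) * taylor (fun z => p (-Complex.I * z)) := by
      rw [taylor_add ((b0.fun_add b1).fun_add b2) b3, taylor_add (b0.fun_add b1) b2,
        taylor_add b0 b1, taylor_mul analyticAt_const a0, taylor_mul analyticAt_const a1,
        taylor_mul analyticAt_const a2, taylor_mul analyticAt_const a3,
        taylor_const, taylor_const, taylor_const]
    rw [← coeff_taylor, e]
    simp only [map_add, PowerSeries.coeff_C_mul, coeff_taylor, taylorCoeff_comp_mul hpa]
    ring
  have hI3 : Complex.I ^ 3 = -Complex.I := by rw [pow_succ, Complex.I_sq]; ring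
  have hI4 : Complex.I ^ 4 = 1 := Complex.I_pow_four
  have hq := (((d0.const_mul (m₀ : ℂ)).fun_add (d1.const_mul (m₁ : ℂ))).fun_add
    (d2.const_mul (m₂ : ℂ))).fun_add (d3.const_mul (m₁ : ℂ))
  refine ⟨_, hq, fun z hz => ?_, ?_, ?_, ?_, ?_, ?_⟩
  · simp only [Complex.add_re, Complex.re_ofReal_mul]
    have k0 := hre _ (hrot _ n0 z hz)
    have k1 := hre _ (hrot _ n1 z hz)
    have k2 := hre _ (hrot _ n2 z hz)
    have k3 := hre _ (hrot _ n3 z hz)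
    have hx2 : 0 ≤ m₁ := by rw [hm₁]; nlinarith
    have : 0 < m₀ := by positivity
    have : 0 ≤ m₂ := by positivity
    positivity
  · simp only [mul_zero, h0, hm₀, hm₁, hm₂]
    push_cast
    ring
  · rw [hcoeff, hm₀, hm₁, hm₂]
    push_cast
    ring
  · rw [hcoeff, neg_sq Complex.I, Complex.I_sq, hm₀, hm₁, hm₂]
    push_cast
    ring
  · rw [hcoeff, neg_pow Complex.I, hI3, hm₀, hm₁, hm₂]
    push_cast
    ring
  · rw [hcoeff, neg_pow Complex.I, hI4, hm₀, hm₁, hm₂]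
    push_cast
    ring

/-- The coefficients of `p = (1 + ω) / (1 - ω)`, in the recursive form that can be solved both for
`p` and for `ω`. -/
theorem taylorCoeff_cayley {p ω : ℂ → ℂ} (hp : DifferentiableOn ℂ p disk)
    (hω : DifferentiableOn ℂ ω disk) (h0 : ω 0 = 0) (hp0 : p 0 = 1)
    (h : ∀ z ∈ disk, p z * (1 - ω z) = 1 + ω z) :
    taylorCoeff p 1 = 2 * taylorCoeff ω 1 ∧
    taylorCoeff p 2 = 2 * taylorCoeff ω 2 + taylorCoeff p 1 * taylorCoeff ω 1 ∧
    taylorCoeff p 3 = 2 * taylorCoeff ω 3 + taylorCoeff p 1 * taylorCoeff ω 2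
      + taylorCoeff p 2 * taylorCoeff ω 1 ∧
    taylorCoeff p 4 = 2 * taylorCoeff ω 4 + taylorCoeff p 1 * taylorCoeff ω 3
      + taylorCoeff p 2 * taylorCoeff ω 2 + taylorCoeff p 3 * taylorCoeff ω 1 := by
  have hpa := analyticAt_of_differentiableOn hp zero_mem_disk
  have hωa := analyticAt_of_differentiableOn hω zero_mem_disk
  have hmul : taylor p * (1 - taylor ω) = 1 + taylor ω := by
    have e1 : taylor (fun z => p z * (1 - ω z)) = taylor (fun z => 1 + ω z) := by
      apply taylor_congr
      filter_upwards [disk_mem_nhds zero_mem_disk] with z hz using h z hz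
    rwa [taylor_mul hpa (by fun_prop), taylor_add (by fun_prop) (by fun_prop),
      taylor_sub (by fun_prop) (by fun_prop), taylor_const, map_one] at e1
  have hω0 : taylorCoeff ω 0 = 0 := by rw [taylorCoeff_zero, h0]
  have hp0' : taylorCoeff p 0 = 1 := by rw [taylorCoeff_zero, hp0]
  have h1 := congrArg (PowerSeries.coeff 1) hmul
  have h2 := congrArg (PowerSeries.coeff 2) hmul
  have h3 := congrArg (PowerSeries.coeff 3) hmul
  have h4 := congrArg (PowerSeries.coeff 4) hmul
  simp [PowerSeries.coeff_mul, Finset.Nat.antidiagonal_succ, coeff_taylor,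
    PowerSeries.coeff_one, hω0, hp0'] at h1 h2 h3 h4
  exact ⟨by linear_combination h1, by linear_combination h2, by linear_combination h3,
    by linear_combination h4⟩

/-! ### Coefficients of functions in the class and the conditions on `φ` -/

/-- The relation between the coefficients of `f` and those of the quotient `F` with
`(2 z f')' = F · (f(z) - f(-z))'`. -/
theorem taylorCoeff_five_of_quot {f F : ℂ → ℂ} (hf : ClassA f) (hF : DifferentiableOn ℂ F disk)
    (h : ∀ z ∈ disk, deriv (fun w => 2 * w * deriv f w) z =
      F z * deriv (fun w => f w - f (-w)) z) :
    20 * taylorCoeff f 5 = taylorCoeff F 4 + taylorCoeff F 2 ^ 2 / 2 := by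
  have hfa := analyticAt_of_differentiableOn hf.holo zero_mem_disk
  have hFa := analyticAt_of_differentiableOn hF zero_mem_disk
  have hf' := hfa.deriv
  have hneg : AnalyticAt ℂ (fun z => f (-1 * z)) 0 := by
    refine AnalyticAt.fun_comp (g := f) (f := fun z => -1 * z) ?_ (by fun_prop)
    simpa using hfa
  have hneg' : AnalyticAt ℂ (fun z => f (-z)) 0 := by simpa using hneg
  have hsub : AnalyticAt ℂ (fun z => f z - f (-z)) 0 := hfa.fun_sub hneg'
  have hL : ∀ n, taylorCoeff (deriv fun w => 2 * w * deriv f w) n =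
      2 * (n + 1) ^ 2 * taylorCoeff f (n + 1) := by
    intro n
    have e : taylor (fun w => 2 * w * deriv f w) =
        PowerSeries.C 2 * PowerSeries.X * taylor (deriv f) := by
      rw [taylor_mul (by fun_prop) hf', taylor_mul (by fun_prop) (by fun_prop), taylor_const,
        taylor_id]
    rw [taylorCoeff_deriv, ← coeff_taylor, e, mul_assoc, PowerSeries.coeff_C_mul,
      mul_comm PowerSeries.X, PowerSeries.coeff_succ_mul_X, coeff_taylor, taylorCoeff_deriv]
    ring
  have hR : ∀ n, taylorCoeff (deriv fun w => f w - f (-w)) n =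
      (n + 1) * (1 - (-1) ^ (n + 1)) * taylorCoeff f (n + 1) := by
    intro n
    rw [taylorCoeff_deriv, ← coeff_taylor, taylor_sub hfa hneg', map_sub, coeff_taylor,
      coeff_taylor]
    have := taylorCoeff_comp_mul hfa (-1) (n + 1)
    simp only [neg_mul, one_mul] at this
    rw [this]
    ring
  have hmul : taylor (deriv fun w => 2 * w * deriv f w) =
      taylor F * taylor (deriv fun w => f w - f (-w)) := by
    rw [← taylor_mul hFa hsub.deriv]
    apply taylor_congr
    filter_upwards [disk_mem_nhds zero_mem_disk] with z hz using h z hz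
  have ha1 : taylorCoeff f 1 = 1 := by rw [taylorCoeff_one, hf.deriv_zero]
  have h0 := congrArg (PowerSeries.coeff 0) hmul
  have h2 := congrArg (PowerSeries.coeff 2) hmul
  have h4 := congrArg (PowerSeries.coeff 4) hmul
  simp only [PowerSeries.coeff_mul, Finset.Nat.antidiagonal_succ, coeff_taylor, hL, hR,
    Finset.Nat.antidiagonal_zero, Finset.map_singleton, Finset.sum_cons, Finset.sum_singleton,
    Finset.map_cons, Function.Embedding.prodMap, Function.Embedding.coeFn_mk, Prod.map] at h0 h2 h4
  norm_num [ha1] at h0 h2 h4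
  rw [h0] at h2 h4
  have e3 : taylorCoeff f 3 = taylorCoeff F 2 / 6 := by linear_combination h2 / 12
  rw [e3] at h4
  linear_combination h4 / 2

/-- What the four coefficient conditions say: three rational expressions in `B₁, …, B₄` are Schur
parameters in `(-1, 1)`, and a fourth one is `x² ∈ (0, 1)`. -/
theorem exists_schur_parameters {B₁ B₂ B₃ B₄ : ℝ} (hB : 0 < B₁) (h1 : C1 B₁ B₂)
    (h2 : C2 B₁ B₂ B₃) (h3 : C3 B₁ B₂ B₃ B₄) (h4 : C4 B₁ B₂) :
    ∃ x s₁ s₂ s₃ ν₂ ν₃ : ℝ, 0 ≤ x ∧ x < 1 ∧ |s₁| < 1 ∧ |s₂| < 1 ∧ |s₃| < 1 ∧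
      (1 - s₁ ^ 2) * s₂ + s₁ ^ 2 = ν₂ ∧
      (1 - s₁ ^ 2) * ((1 - s₂ ^ 2) * s₃ - s₁ * s₂ ^ 2) + 2 * s₁ * (1 - s₁ ^ 2) * s₂
        + s₁ ^ 3 = ν₃ ∧
      B₁ * (1 + s₁) * x ^ 2 = B₁ - B₂ ∧
      2 * B₁ * (1 + s₁) * x ^ 4 = 2 * B₁ - 2 * B₂ - B₁ ^ 2 ∧
      3 * B₁ * (1 + 2 * s₁ + ν₂) * x ^ 4 = 3 * B₁ - 6 * B₂ - B₁ ^ 2 + 3 * B₃ + B₁ * B₂ ∧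
      2 * B₁ * (1 + 3 * s₁ + 3 * ν₂ + ν₃) * x ^ 4 =
        2 * B₁ - 6 * B₂ - B₁ ^ 2 + 6 * B₃ + 2 * B₁ * B₂ - 2 * B₄ - B₂ ^ 2 := by
  unfold C1 at h1
  unfold C2 at h2
  unfold C3 at h3
  obtain ⟨hX0, hX1⟩ := h4
  set N₁ := B₁ ^ 3 - 2 * B₁ * B₂ + 2 * B₂ ^ 2 with hN₁
  set N₂ := B₁ ^ 3 - B₁ ^ 2 * B₂ + 3 * B₂ ^ 2 - 3 * B₁ * B₃ with hN₂
  generalize hN₃ : B₁ ^ 7 - B₁ ^ 6 * (8 * B₂ + 3) - _ + _ + _ - _ + _ + _ = N₃ at h3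
  set u := 2 * B₁ - B₁ ^ 2 - 2 * B₂ with hu
  set E := B₁ ^ 3 - B₁ ^ 2 + B₂ ^ 2 with hE
  set V := B₁ * (2 * B₁ + B₂ - 3) + 3 * B₃ with hV
  set W := 4 * B₁ ^ 3 + 6 * B₂ ^ 2 - B₁ ^ 2 * (B₂ + 3) - 3 * B₁ * B₃ with hW
  have e1 : 2 * B₁ ^ 2 - B₁ ^ 3 - 2 * B₁ * B₂ = B₁ * u := by rw [hu]; ring
  -- The factor `(B₁ - 2) B₁ + 2 B₂` is `-u`, whence the sign in the choice of `s₃`.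
  have e3 : 2 * |((B₁ - 2) * B₁ + 2 * B₂) * V * W| = |2 * u * V * W| := by
    rw [show (B₁ - 2) * B₁ + 2 * B₂ = -u by rw [hu]; ring, neg_mul, neg_mul, abs_neg,
      mul_assoc 2 u, mul_assoc 2 (u * V), abs_mul 2, abs_two]
  have e2 : 3 * |E| = |3 * E| := by rw [abs_mul, abs_of_pos (three_pos (α := ℝ))]
  rw [e1] at h1
  rw [e2] at h2
  rw [e3] at h3
  -- A vanishing `B₁ - B₂` would make the quotient in C4 the junk value `0`, which C4 excludes.
  have hu0 : u ≠ 0 := by rintro h; simp [h] at hX0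
  have hd0 : B₁ - B₂ ≠ 0 := by rintro h; simp [h] at hX0
  have hlt : ∀ {a b : ℝ}, |a| < |b| → b ≠ 0 ∧ |a / b| < 1 := fun {a b} h => by
    have hb : 0 < |b| := (abs_nonneg a).trans_lt h
    exact ⟨abs_pos.1 hb, by rwa [abs_div, div_lt_one hb]⟩
  obtain ⟨hE0, hs₂⟩ := hlt h2
  obtain ⟨hVW0, hs₃⟩ := hlt h3
  have hV0 : V ≠ 0 := by rintro h; simp [h] at hVW0
  have hW0 : W ≠ 0 := by rintro h; simp [h] at hVW0
  have hE0 : E ≠ 0 := by rintro h; simp [h] at hE0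
  have hB0 := hB.ne'
  have hx2 := Real.sq_sqrt hX0.le
  have hx4 : √(u / (2 * (B₁ - B₂))) ^ 4 = (u / (2 * (B₁ - B₂))) ^ 2 := by
    rw [show 4 = 2 * 2 from rfl, pow_mul, hx2]
  -- The denominators `1 - s₁²` and `1 - s₂²` factor, by which the right-hand sides of the next
  -- condition arise: `E` comes from the first of them, `V` and `W` from the second.
  have f1 : 1 + N₁ / (B₁ * u) = 2 * (B₁ - B₂) ^ 2 / (B₁ * u) := by
    field_simp
    rw [hu, hN₁]; ring
  have f2 : 1 - (N₁ / (B₁ * u)) ^ 2 = -4 * (B₁ - B₂) ^ 2 * E / (B₁ ^ 2 * u ^ 2) := by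
    field_simp
    rw [hu, hN₁, hE]; ring
  have f3 : (1 - (N₁ / (B₁ * u)) ^ 2) * (N₂ / (3 * E)) =
      -4 * (B₁ - B₂) ^ 2 * N₂ / (3 * B₁ ^ 2 * u ^ 2) := by
    rw [f2]; field_simp
  have f4 : 1 - (N₂ / (3 * E)) ^ 2 = B₁ * V * W / (9 * E ^ 2) := by
    field_simp
    rw [hN₂, hE, hV, hW]; ring
  have f5 : (1 - (N₁ / (B₁ * u)) ^ 2) * ((1 - (N₂ / (3 * E)) ^ 2) * (-N₃ / (2 * u * V * W))
        - N₁ / (B₁ * u) * (N₂ / (3 * E)) ^ 2) =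
      (B₁ - B₂) ^ 2 * (2 * B₁ ^ 2 * N₃ + 4 * N₁ * N₂ ^ 2) / (9 * B₁ ^ 3 * u ^ 3 * E) := by
    rw [f2, f4]; field_simp; ring
  refine ⟨√(u / (2 * (B₁ - B₂))), N₁ / (B₁ * u), N₂ / (3 * E), -N₃ / (2 * u * V * W), _, _,
    Real.sqrt_nonneg _, (Real.sqrt_lt' one_pos).2 (by simpa using hX1), (hlt h1).2, hs₂,
    by rwa [neg_div, abs_neg], rfl, rfl, ?_, ?_, ?_, ?_⟩
  · rw [hx2, f1]
    field_simp
  · rw [hx4, f1]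
    field_simp
    rw [hu]; ring
  · rw [hx4, f3]
    field_simp
    rw [hu, hN₁, hN₂]; ring
  · rw [hx4, f5, mul_assoc (2 * (N₁ / (B₁ * u))), f3]
    field_simp
    rw [← hN₃, hu, hN₁, hN₂, hE]; ring

/-! ### The bound and the extremal function -/

theorem IsSchwarz.exists_cayley {ω : ℂ → ℂ} (hω : IsSchwarz ω) :
    ∃ p : ℂ → ℂ, DifferentiableOn ℂ p disk ∧ (∀ z ∈ disk, 0 < (p z).re) ∧ p 0 = 1 ∧
      ∀ z ∈ disk, p z * (1 - ω z) = 1 + ω z := by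
  have hb : ∀ z ∈ disk, ‖ω z‖ < 1 := fun z hz => mem_disk.1 (hω.maps hz)
  have hd := hω.holo
  have hne : ∀ z ∈ disk, 1 - ω z ≠ 0 := fun z hz => one_sub_ne_zero_of_norm_lt (hb z hz)
  exact ⟨fun z => (1 + ω z) / (1 - ω z), DifferentiableOn.div (by fun_prop) (by fun_prop) hne,
    fun z hz => re_one_add_div_one_sub_pos (hb z hz), by simp [hω.map_zero],
    fun z hz => div_mul_cancel₀ _ (hne z hz)⟩

theorem exists_schwarz_of_re_pos {q : ℂ → ℂ} (hq : DifferentiableOn ℂ q disk)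
    (hre : ∀ z ∈ disk, 0 < (q z).re) (h0 : q 0 = 1) :
    ∃ w : ℂ → ℂ, IsSchwarz w ∧ ∀ z ∈ disk, q z * (1 - w z) = 1 + w z := by
  have hne : ∀ z ∈ disk, q z + 1 ≠ 0 := fun z hz h => by
    have h1 := congrArg Complex.re h
    have h2 := hre z hz
    simp at h1
    linarith
  refine ⟨fun z => (q z - 1) / (q z + 1),
    ⟨DifferentiableOn.div (by fun_prop) (by fun_prop) hne,
      fun z hz => mem_disk.2 (norm_sub_one_div_add_one_lt (hre z hz)), by simp [h0]⟩,
    fun z hz => ?_⟩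
  have := hne z hz
  field_simp
  ring

theorem norm_taylorCoeff_five_le {φ : ℂ → ℂ} {B : ℕ → ℝ} (hφ : Admissible φ B)
    (h1 : C1 (B 1) (B 2)) (h2 : C2 (B 1) (B 2) (B 3)) (h3 : C3 (B 1) (B 2) (B 3) (B 4))
    (h4 : C4 (B 1) (B 2)) {f : ℂ → ℂ} (hf : ClassCs φ f) : ‖taylorCoeff f 5‖ ≤ B 1 / 20 := by
  obtain ⟨ω, hω, hsub⟩ := hf.subord
  have hF : DifferentiableOn ℂ (fun z => φ (ω z)) disk := hφ.holo.comp hω.holo hω.maps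
  have hfive := taylorCoeff_five_of_quot hf.classA hF fun z hz =>
    (div_eq_iff (hf.denom_ne z hz)).1 (hsub z hz)
  obtain ⟨-, hF2, -, hF4⟩ := taylorCoeff_comp
    (analyticAt_of_differentiableOn hφ.holo zero_mem_disk)
    (analyticAt_of_differentiableOn hω.holo zero_mem_disk) hω.map_zero
  simp only [hφ.coeff] at hF2 hF4
  obtain ⟨p, hp, hpre, hp0, hpω⟩ := hω.exists_cayley
  obtain ⟨k1, k2, k3, k4⟩ := taylorCoeff_cayley hp hω.holo hω.map_zero hp0 hpω
  obtain ⟨x, s₁, s₂, s₃, ν₂, ν₃, hx0, hx1, hs₁, hs₂, hs₃, hν₂, hν₃, r1, r2, r3, r4⟩ :=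
    exists_schur_parameters hφ.B_one_pos h1 h2 h3 h4
  obtain ⟨q, hq, hqre, hq0, hq1, hq2, hq3, hq4⟩ := exists_average_rotations hp hpre hp0 hx0 hx1
  obtain ⟨w, hw, hqw⟩ := exists_schwarz_of_re_pos hq hqre hq0
  obtain ⟨l1, l2, l3, l4⟩ := taylorCoeff_cayley hq hw.holo hw.map_zero hq0 hqw
  obtain ⟨P, hP, hPre, hP0, hP1, hP2, hP3⟩ := exists_caratheodory hs₁ hs₂ hs₃
  have hbound := norm_average_rotation_le hw hP hPre hP0
  have hP2' : taylorCoeff P 2 / 2 = (ν₂ : ℂ) := by rw [hP2, ← hν₂]; push_cast; ring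
  have hP3' : taylorCoeff P 3 / 2 = (ν₃ : ℂ) := by rw [hP3, ← hν₃]; push_cast; ring
  rw [hP1, hP2', hP3'] at hbound
  -- Everything is expressed in terms of the coefficients of `p`.
  set p₁ := taylorCoeff p 1
  set p₂ := taylorCoeff p 2
  set p₃ := taylorCoeff p 3
  set p₄ := taylorCoeff p 4
  rw [hq1] at l1 l2 l3 l4
  rw [hq2] at l2 l3 l4
  rw [hq3] at l3 l4
  rw [hq4] at l4
  have c1 : taylorCoeff ω 1 = p₁ / 2 := by linear_combination -k1 / 2
  rw [c1] at k2 k3 k4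
  have c2 : taylorCoeff ω 2 = p₂ / 2 - p₁ ^ 2 / 4 := by linear_combination -k2 / 2
  rw [c2] at k3 k4
  have c3 : taylorCoeff ω 3 = p₃ / 2 - p₁ * p₂ / 2 + p₁ ^ 3 / 8 := by linear_combination -k3 / 2
  rw [c3] at k4
  have c4 : taylorCoeff ω 4 = p₄ / 2 - p₁ * p₃ / 2 - p₂ ^ 2 / 4 + 3 * p₁ ^ 2 * p₂ / 8
    - p₁ ^ 4 / 16 := by linear_combination -k4 / 2
  have w1 : taylorCoeff w 1 = x * p₁ / 2 := by linear_combination -l1 / 2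
  rw [w1] at l2 l3 l4
  have w2 : taylorCoeff w 2 = (x : ℂ) ^ 2 * (p₂ / 2 - p₁ ^ 2 / 4) := by linear_combination -l2 / 2
  rw [w2] at l3 l4
  have w3 : taylorCoeff w 3 = x * p₃ / 2 - (x : ℂ) ^ 3 * p₁ * p₂ / 2
    + (x : ℂ) ^ 3 * p₁ ^ 3 / 8 := by linear_combination -l3 / 2
  rw [w3] at l4
  have w4 : taylorCoeff w 4 = p₄ / 2 - (x : ℂ) ^ 2 * p₁ * p₃ / 2 - (x : ℂ) ^ 4 * p₂ ^ 2 / 4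
    + 3 * (x : ℂ) ^ 4 * p₁ ^ 2 * p₂ / 8 - (x : ℂ) ^ 4 * p₁ ^ 4 / 16 := by
    linear_combination -l4 / 2
  have r1' := congrArg ((↑) : ℝ → ℂ) r1
  have r2' := congrArg ((↑) : ℝ → ℂ) r2
  have r3' := congrArg ((↑) : ℝ → ℂ) r3
  have r4' := congrArg ((↑) : ℝ → ℂ) r4
  push_cast at r1' r2' r3' r4'
  rw [hF2, hF4, c1, c2, c3, c4] at hfive
  rw [w1, w2, w3, w4] at hbound
  -- The coefficients of `p₁ p₃`, `p₂²`, `p₁² p₂` and `p₁⁴` agree by the four relations between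
  -- the parameters and the `B n`.
  have key : 20 * taylorCoeff f 5 = (B 1 : ℂ) * (p₄ / 2 - (x : ℂ) ^ 2 * p₁ * p₃ / 2
      - (x : ℂ) ^ 4 * p₂ ^ 2 / 4 + 3 * (x : ℂ) ^ 4 * p₁ ^ 2 * p₂ / 8 - (x : ℂ) ^ 4 * p₁ ^ 4 / 16
      - (2 * (x * p₁ / 2) * (x * p₃ / 2 - (x : ℂ) ^ 3 * p₁ * p₂ / 2 + (x : ℂ) ^ 3 * p₁ ^ 3 / 8)
        + ((x : ℂ) ^ 2 * (p₂ / 2 - p₁ ^ 2 / 4)) ^ 2) * s₁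
      + 3 * (x * p₁ / 2) ^ 2 * ((x : ℂ) ^ 2 * (p₂ / 2 - p₁ ^ 2 / 4)) * ν₂
      - (x * p₁ / 2) ^ 4 * ν₃) := by
    linear_combination hfive + p₁ * p₃ / 2 * r1' + p₂ ^ 2 / 8 * r2' - p₁ ^ 2 * p₂ / 8 * r3'
      + p₁ ^ 4 / 32 * r4'
  have hnorm := congrArg norm key
  rw [norm_mul, norm_mul, Complex.norm_real, Real.norm_of_nonneg hφ.B_one_pos.le] at hnorm
  have h20 : ‖(20 : ℂ)‖ = 20 := by simp
  rw [h20] at hnorm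
  have := mul_le_mul_of_nonneg_left hbound hφ.B_one_pos.le
  rw [← hnorm] at this
  linarith

/-- The extremal function: with `h' / h = (φ(z⁴) - 1) / z`, a primitive `g` of the even function
`h` is odd and satisfies `(z g')' = φ(z⁴) g'`. -/
theorem exists_extremal {φ : ℂ → ℂ} {B : ℕ → ℝ} (hφ : Admissible φ B) :
    ∃ g : ℂ → ℂ, ClassCs φ g ∧ (∀ z ∈ disk, symConvexQuot g z = φ (z ^ 4)) ∧
      taylorCoeff g 5 = ((B 1 / 20 : ℝ) : ℂ) := by
  have hpow : ∀ z ∈ disk, z ^ 4 ∈ disk := fun z hz => by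
    rw [mem_disk, norm_pow]
    exact pow_lt_one₀ (norm_nonneg _) (mem_disk.1 hz) four_ne_zero
  have hnegm : ∀ z ∈ disk, -z ∈ disk := fun z hz => by
    rw [mem_disk, norm_neg]; exact mem_disk.1 hz
  have hK : DifferentiableOn ℂ (dslope φ 0) disk :=
    (Complex.differentiableOn_dslope (disk_mem_nhds zero_mem_disk)).2 hφ.holo
  have hφK : ∀ z, z * dslope φ 0 z = φ z - 1 := fun z => by
    have := sub_smul_dslope φ 0 z
    simpa [hφ.map_zero] using this
  obtain ⟨M, hM⟩ := DifferentiableOn.isExactOn_ball hK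
  set h : ℂ → ℂ := fun z => Complex.exp ((M (z ^ 4) - M 0) / 4) with hh
  have hhne : ∀ z, h z ≠ 0 := fun z => Complex.exp_ne_zero _
  have hheven : ∀ z, h (-z) = h z := fun z => by simp only [hh]; rw [Even.neg_pow (by decide)]
  have hhd : ∀ z ∈ disk, HasDerivAt h (h z * (z ^ 3 * dslope φ 0 (z ^ 4))) z := fun z hz => by
    have e1 : HasDerivAt (fun z : ℂ => M (z ^ 4)) (dslope φ 0 (z ^ 4) * (4 * z ^ 3)) z := by
      have := (hM _ (hpow z hz)).comp z (hasDerivAt_pow 4 z)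
      simpa [Function.comp_def] using this
    have e2 := ((e1.sub_const (M 0)).div_const 4).cexp
    refine e2.congr_deriv ?_
    simp only [hh]
    ring
  have hhD : DifferentiableOn ℂ h disk := fun z hz =>
    (hhd z hz).differentiableAt.differentiableWithinAt
  obtain ⟨G, hG⟩ := DifferentiableOn.isExactOn_ball hhD
  set g : ℂ → ℂ := fun z => G z - G 0 with hg
  have hgd : ∀ z ∈ disk, HasDerivAt g (h z) z := fun z hz => (hG z hz).sub_const _
  have hden : ∀ z ∈ disk, deriv (fun w => g w - g (-w)) z = 2 * h z := fun z hz => by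
    have e1 : HasDerivAt (fun w => g (-w)) (-h z) z := by
      have := (hgd _ (hnegm z hz)).comp z (hasDerivAt_neg z)
      rw [hheven] at this
      simpa [Function.comp_def] using this
    rw [((hgd z hz).fun_sub e1).deriv]
    ring
  have hnum : ∀ z ∈ disk, deriv (fun w => 2 * w * deriv g w) z = φ (z ^ 4) * (2 * h z) := by
    intro z hz
    have e1 : (fun w => 2 * w * deriv g w) =ᶠ[𝓝 z] fun w => 2 * w * h w := by
      filter_upwards [disk_mem_nhds hz] with w hw
      rw [(hgd w hw).deriv]
    have e2 := ((hasDerivAt_id z).const_mul 2).fun_mul (hhd z hz)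
    simp only [id] at e2
    rw [e1.deriv_eq, e2.deriv]
    linear_combination 2 * h z * hφK (z ^ 4)
  have hquot : ∀ z ∈ disk, symConvexQuot g z = φ (z ^ 4) := fun z hz => by
    rw [symConvexQuot, hnum z hz, hden z hz]
    exact mul_div_cancel_right₀ _ (mul_ne_zero two_ne_zero (hhne z))
  have hA : ClassA g :=
    ⟨fun z hz => (hgd z hz).differentiableAt.differentiableWithinAt, by simp [hg],
      by rw [(hgd 0 zero_mem_disk).deriv]; simp [hh]⟩
  refine ⟨g, ⟨hA, fun z hz => ?_, fun z => z ^ 4, ⟨by fun_prop, hpow, by simp⟩, hquot⟩,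
    hquot, ?_⟩
  · rw [hden z hz]
    exact mul_ne_zero two_ne_zero (hhne z)
  · have hF : DifferentiableOn ℂ (fun z => φ (z ^ 4)) disk := hφ.holo.comp (by fun_prop) hpow
    have hfive := taylorCoeff_five_of_quot hA hF fun z hz => by rw [hnum z hz, hden z hz]
    have hpow4 : ∀ n, taylorCoeff (fun z => z ^ 4) n = if n = 4 then 1 else 0 := fun n => by
      have e : taylor (fun z => z ^ 4) = PowerSeries.X ^ 4 := by
        simp only [pow_succ, pow_zero, one_mul]
        rw [taylor_mul (by fun_prop) (by fun_prop), taylor_mul (by fun_prop) (by fun_prop),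
          taylor_mul (by fun_prop) (by fun_prop), taylor_id]
      rw [← coeff_taylor, e, PowerSeries.coeff_X_pow]
    obtain ⟨-, hF2, -, hF4⟩ := taylorCoeff_comp (ω := fun z => z ^ 4)
      (analyticAt_of_differentiableOn hφ.holo zero_mem_disk) (by fun_prop) (by simp)
    simp [hφ.coeff, hpow4] at hF2 hF4
    rw [hF2, hF4] at hfive
    push_cast
    linear_combination hfive / 20

end Sakaguchi

theorem theorem2 (φ : ℂ → ℂ) (B : ℕ → ℝ) (hφ : Sakaguchi.Admissible φ B)
    (h1 : Sakaguchi.C1 (B 1) (B 2))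
    (h2 : Sakaguchi.C2 (B 1) (B 2) (B 3))
    (h3 : Sakaguchi.C3 (B 1) (B 2) (B 3) (B 4))
    (h4 : Sakaguchi.C4 (B 1) (B 2)) :
    (∀ f : ℂ → ℂ, Sakaguchi.ClassCs φ f → ‖Sakaguchi.taylorCoeff f 5‖ ≤ B 1 / 20) ∧
    (∃ g : ℂ → ℂ, Sakaguchi.ClassCs φ g ∧
      (∀ z ∈ Sakaguchi.disk, Sakaguchi.symConvexQuot g z = φ (z ^ 4)) ∧
      Sakaguchi.taylorCoeff g 5 = ((B 1 / 20 : ℝ) : ℂ)) :=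
  ⟨fun _ hf => Sakaguchi.norm_taylorCoeff_five_le hφ h1 h2 h3 h4 hf,
    Sakaguchi.exists_extremal hφ⟩
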